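/- **Theorem 1 (Local output consistency).** There is an absolute constant $C>0$ such that the following holds. Let $\mathcal X\subseteq\mathbb R^d$, let $D$ be a probability distribution of pairs $(x,y)$ on $\mathcal X\times[K]$, where $[K]=\{1,\dots,K\}$, and let $D_{x\mid y=j}$ be the conditional distribution of $x$ given $y=j$. Let $\mathcal F_{1}=\{f_{w_1}:\mathcal X\to\mathbb R^K,\ w_1\in\mathcal W_1\}$ and $\mathcal F_{2}=\{f_{w_2}:\mathcal X\to\mathbb R^K,\ w_2\in\mathcal W_2\}$ be two parametrized classes of measurable models (with arbitrary parameter sets; one-element sets, i.e. two individual models, are allowed), and write $f^{\mathcal S}=\mathrm{softmax}\circ f$, with coordinates $f^{\mathcal S_k}$, $k\in[K]$. Fix a target class $j\in[K]$, a radius $r>0$, $\gamma\in\mathbb R$ and $\delta\in(0,1)$. Let $S=\{(x_i,y_i)\}_{i=1}^n$ be an i.i.d. dataset from $D$, and let $(x_0,j)\in S$ be one of its samples of class $j$; that is, for an index $i_0$ chosen in advance, $S$ is conditioned on $(x_{i_0},y_{i_0})=(x_0,j)$, the other $n-1$ samples being i.i.d. from $D$. Put $B(x_0,r)=\{x\in\mathbb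 R^d:\|x-x_0\|_2\le r\}$, $$\mathcal I=\{i: y_i=j,\ x_i\in B(x_0,r)\},\qquad \rho=\frac{|\mathcal I|}{\mathrm{vol}\,B(x_0,r)}$$ (the local sample density). Then with probability at least $1-\delta$ over $S$ the following implication holds: if the two classes differ on average by at most $\gamma$ on the training samples of class $j$ in $B(x_0,r)$, i.e. $$\frac1{|\mathcal I|}\Big|\sum_{i\in\mathcal I}\big(f_{w_1}^{\mathcal S_k}(x_i)-f_{w_2}^{\mathcal S_k}(x_i)\big)\Big|\le\gamma\qquad\text{for all }k\in[K],\ w_1\in\mathcal W_1,\ w_2\in\mathcal W_2,$$ then for all $w_1\in\mathcal W_1$, $w_2\in\mathcal W_2$ $$\Big\|\mathbb E_{x\sim D_{x\mid y=j}}\big[f_{w_1}^{\mathcal S}(x)-f_{w_2}^{\mathcal S}(x)\,\big|\,x\in B(x_0,r)\big]\Big\|_\infty\le C\left(\sqrt{\frac{K d^{d/2}}{\rho\,2^d r^d}}\;\log^2\!\big(r^d\sqrt{\rho}\big)+\sqrt{\frac{d^{d/2}\log(2K/\delta)}{\rho\,2^{d+1}r^d}}\right)+\gamma .$$ (The conditional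 expectation is read as $0$ where the conditioning event has probability $0$.) -/

import Mathlib

open MeasureTheory ProbabilityTheory

noncomputable section

namespace LocalConsistency

/-- The softmax transformation `ℝ^K → ℝ^K`. -/
def softmax {K : ℕ} (v : Fin K → ℝ) : Fin K → ℝ :=
  fun k => Real.exp (v k) / ∑ l, Real.exp (v l)

/-- A dataset of `n` labelled samples `(x_i, y_i)` with `x_i ∈ 𝒳 ⊆ ℝ^d` and `y_i ∈ [K]`. -/
abbrev Dataset {d : ℕ} (𝒳 : Set (EuclideanSpace ℝ (Fin d))) (K n : ℕ) : Type :=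
  Fin n → 𝒳 × Fin K

/-- The indices of the samples of class `j` that lie in the closed Euclidean ball `B(x₀, r)`. -/
def localIndices {d K n : ℕ} {𝒳 : Set (EuclideanSpace ℝ (Fin d))}
    (S : Dataset 𝒳 K n) (j : Fin K) (x₀ : 𝒳) (r : ℝ) : Finset (Fin n) :=
  open Classical in
  Finset.univ.filter fun i => (S i).2 = j ∧
    ((S i).1 : EuclideanSpace ℝ (Fin d)) ∈ Metric.closedBall (x₀ : EuclideanSpace ℝ (Fin d)) r

/-- The `(j, x₀, r)`-local sample density: the number of samples of class `j` in `B(x₀, r)`,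
divided by the volume of `B(x₀, r)`. -/
def localDensity {d K n : ℕ} {𝒳 : Set (EuclideanSpace ℝ (Fin d))}
    (S : Dataset 𝒳 K n) (j : Fin K) (x₀ : 𝒳) (r : ℝ) : ℝ :=
  ((localIndices S j x₀ r).card : ℝ) /
    volume.real (Metric.closedBall (x₀ : EuclideanSpace ℝ (Fin d)) r)

/-- The conditional distribution of `x` given `y = j`, when `(x, y)` has law `D`. -/
def classLaw {d K : ℕ} {𝒳 : Set (EuclideanSpace ℝ (Fin d))}
    (D : Measure (𝒳 × Fin K)) (j : Fin K) : Measure 𝒳 :=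
  (cond D {z | z.2 = j}).map Prod.fst

/-- The points of `𝒳` in `B(x₀, r)`. The sample space is the full product `𝒳 × [K]`, so that
membership in class `j` enters through `classLaw D j`. -/
def localRegion {d : ℕ} {𝒳 : Set (EuclideanSpace ℝ (Fin d))} (x₀ : 𝒳) (r : ℝ) : Set 𝒳 :=
  {x | (x : EuclideanSpace ℝ (Fin d)) ∈ Metric.closedBall (x₀ : EuclideanSpace ℝ (Fin d)) r}

/-- The conditional expectation, given that `x` lies in the local region, of the difference of
the softmax outputs of two models, for `x` drawn from the class-`j` distribution. -/
def localMeanDiff {d K : ℕ} {𝒳 : Set (EuclideanSpace ℝ (Fin d))}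
    (D : Measure (𝒳 × Fin K)) (j : Fin K) (x₀ : 𝒳) (r : ℝ)
    (g₁ g₂ : 𝒳 → Fin K → ℝ) : Fin K → ℝ :=
  ∫ x, (softmax (g₁ x) - softmax (g₂ x)) ∂(cond (classLaw D j) (localRegion x₀ r))

/-- The two models differ on average by at most `γ` over the class-`j` samples in `B(x₀, r)`,
in every softmax coordinate. -/
def EmpiricallyClose {d K n : ℕ} {𝒳 : Set (EuclideanSpace ℝ (Fin d))}
    (S : Dataset 𝒳 K n) (j : Fin K) (x₀ : 𝒳) (r γ : ℝ) (g₁ g₂ : 𝒳 → Fin K → ℝ) : Prop :=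
  ∀ k : Fin K, (1 / ((localIndices S j x₀ r).card : ℝ)) *
    |∑ i ∈ localIndices S j x₀ r, (softmax (g₁ (S i).1) k - softmax (g₂ (S i).1) k)| ≤ γ

/-- The law of an i.i.d. dataset of size `n` from `D`, conditioned on its `i₀`-th sample being
`(x₀, j)`: the `i₀`-th sample is `(x₀, j)` and the others are independent with law `D`. -/
def datasetLaw {d K n : ℕ} {𝒳 : Set (EuclideanSpace ℝ (Fin d))}
    (D : Measure (𝒳 × Fin K)) (i₀ : Fin n) (x₀ : 𝒳) (j : Fin K) : Measure (Dataset 𝒳 K n) :=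
  Measure.pi fun i => if i = i₀ then Measure.dirac (x₀, j) else D

/-- The order of the deviation, where `ρ` is the local sample density. -/
def deviationRate (d K : ℕ) (r δ ρ : ℝ) : ℝ :=
  Real.sqrt ((K : ℝ) * (d : ℝ) ^ ((d : ℝ) / 2) / (ρ * 2 ^ d * r ^ d)) *
      Real.log (r ^ d * Real.sqrt ρ) ^ 2 +
    Real.sqrt ((d : ℝ) ^ ((d : ℝ) / 2) * Real.log (2 * (K : ℝ) / δ) / (ρ * 2 ^ (d + 1) * r ^ d))

end LocalConsistency

end

/-! No uniform convergence over the two classes is needed. The closeness hypothesis speaks of all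
pairs, so the implication fails only if some pair whose local means are far apart is empirically
close. The bound depends on `S` only through the set `I` of local indices. Once `I` is fixed, a far
pair, and a coordinate where it is far, can be chosen independently of the sample values. Hoeffding
for that single function then suffices (`datasetLaw_empiricallyClose_le`). The event that the local
indices are `I` is a product set, so conditioning on it keeps the samples independent; those in `I`
other than `i₀` follow `D` conditioned on `localEvent`. The deterministic sample `i₀` is absorbed
into the constant. Summing over `I` concludes (`measure_le_of_forall_fiber`). -/

namespace LocalConsistency

/-! ### Volume of the ball and a lower bound for the rate. -/

section Volume

/-- A Euclidean ball contains the cube inscribed in it. -/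
theorem inscribedCube_le_volume_closedBall {d : ℕ} (x : EuclideanSpace ℝ (Fin d)) {r : ℝ}
    (hr : 0 ≤ r) :
    (2 * (r / √(d : ℝ))) ^ d ≤ volume.real (Metric.closedBall x r) := by
  have ha : 0 ≤ r / √(d : ℝ) := by positivity
  have hsub : (@WithLp.ofLp 2 (Fin d → ℝ)) ⁻¹' Metric.closedBall (WithLp.ofLp x) (r / √(d : ℝ)) ⊆
      Metric.closedBall x r := by
    intro y hy
    rw [Set.mem_preimage, Metric.mem_closedBall, dist_pi_le_iff ha] at hy
    rw [Metric.mem_closedBall, EuclideanSpace.dist_eq]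
    refine Real.sqrt_le_iff.2 ⟨hr, ?_⟩
    calc ∑ i, dist (y i) (x i) ^ 2 ≤ ∑ _i : Fin d, (r / √(d : ℝ)) ^ 2 :=
          Finset.sum_le_sum fun i _ => pow_le_pow_left₀ dist_nonneg (hy i) 2
      _ = d * (r ^ 2 / d) := by
          rw [Finset.sum_const, Finset.card_univ, Fintype.card_fin, nsmul_eq_mul, div_pow,
            Real.sq_sqrt d.cast_nonneg]
      _ ≤ r ^ 2 := by
          rcases Nat.eq_zero_or_pos d with rfl | hd
          · simp [sq_nonneg]
          · have : (d : ℝ) ≠ 0 := by positivity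
            rw [mul_div_cancel₀ _ this]
  have hvol : volume.real ((@WithLp.ofLp 2 (Fin d → ℝ)) ⁻¹'
      Metric.closedBall (WithLp.ofLp x) (r / √(d : ℝ))) = (2 * (r / √(d : ℝ))) ^ d := by
    rw [Measure.real, (PiLp.volume_preserving_ofLp (Fin d)).measure_preimage
      measurableSet_closedBall.nullMeasurableSet, Real.volume_pi_closedBall _ ha,
      ENNReal.toReal_ofReal (by positivity), Fintype.card_fin]
  rw [← hvol]
  exact measureReal_mono hsub measure_closedBall_lt_top.ne

theorem one_le_volume_closedBall_ratio {d : ℕ} (x : EuclideanSpace ℝ (Fin d)) {r : ℝ}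
    (hr : 0 < r) :
    1 ≤ (d : ℝ) ^ ((d : ℝ) / 2) * volume.real (Metric.closedBall x r) / (2 ^ d * r ^ d) := by
  rw [le_div_iff₀ (by positivity), one_mul]
  have hd : (d : ℝ) ^ ((d : ℝ) / 2) = √(d : ℝ) ^ d := by
    rw [Real.sqrt_eq_rpow, ← Real.rpow_natCast, ← Real.rpow_mul d.cast_nonneg]
    congr 1; ring
  calc (2 : ℝ) ^ d * r ^ d = √(d : ℝ) ^ d * (2 * (r / √(d : ℝ))) ^ d := by
        rw [← mul_pow, ← mul_pow]
        rcases Nat.eq_zero_or_pos d with rfl | hd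
        · simp
        · have : √(d : ℝ) ≠ 0 := by positivity
          congr 1; field_simp
    _ ≤ _ := by
        rw [hd]
        gcongr
        exact inscribedCube_le_volume_closedBall x hr.le

/-- The second summand of the rate already dominates the Hoeffding deviation; the `log ^ 2` summand
is only used as nonnegative. -/
theorem sqrt_le_deviationRate {d K m : ℕ} (x : EuclideanSpace ℝ (Fin d)) {r δ : ℝ}
    (hr : 0 < r) (hL : 0 ≤ Real.log (2 * (K : ℝ) / δ)) :
    √(Real.log (2 * (K : ℝ) / δ) / (2 * m)) ≤
      deviationRate d K r δ ((m : ℝ) / volume.real (Metric.closedBall x r)) := by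
  have hV : 0 < volume.real (Metric.closedBall x r) :=
    ENNReal.toReal_pos (Metric.measure_closedBall_pos volume x hr).ne'
      measure_closedBall_lt_top.ne
  have h1 := one_le_volume_closedBall_ratio x hr
  set V := volume.real (Metric.closedBall x r)
  set L := Real.log (2 * (K : ℝ) / δ)
  unfold deviationRate
  refine le_add_of_nonneg_of_le (by positivity) (Real.sqrt_le_sqrt ?_)
  calc L / (2 * m) ≤ L / (2 * m) * ((d : ℝ) ^ ((d : ℝ) / 2) * V / (2 ^ d * r ^ d)) :=
        le_mul_of_one_le_right (by positivity) h1
    _ = _ := by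
        rw [pow_succ]
        rcases Nat.eq_zero_or_pos m with rfl | hm
        · simp
        · field_simp
          exact mul_comm _ _

end Volume

/-! ### Hoeffding's inequality on product spaces. -/

section Concentration

variable {ι Ω : Type*} [Fintype ι] [MeasurableSpace Ω]

theorem cond_pi_univ_pi (μ : ι → Measure Ω) [∀ i, IsProbabilityMeasure (μ i)] (s : ι → Set Ω)
    (hs : ∀ i, MeasurableSet (s i)) (h0 : ∀ i, μ i (s i) ≠ 0) :
    cond (Measure.pi μ) (Set.univ.pi s) = Measure.pi fun i => cond (μ i) (s i) := by
  have := fun i => cond_isProbabilityMeasure (h0 i)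
  refine (Measure.pi_eq fun t ht => ?_).symm
  rw [cond_apply (MeasurableSet.univ_pi hs), ← Set.pi_inter_distrib, Measure.pi_pi, Measure.pi_pi,
    ENNReal.prod_inv_distrib, ← Finset.prod_mul_distrib]
  · exact Finset.prod_congr rfl fun i _ => (cond_apply (hs i) _ _).symm
  · exact fun i _ j _ _ => Or.inr (measure_ne_top _ _)

theorem pi_measure_sum_ge_le (ν : ι → Measure Ω) [∀ i, IsProbabilityMeasure (ν i)]
    (t : Finset ι) {h : Ω → ℝ} (hm : Measurable h) (hb : ∀ z, h z ∈ Set.Icc (-1) 1) {a : ℝ}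
    (ha : ∀ i ∈ t, ∫ z, h z ∂ν i = a) {ε : ℝ} (hε : 0 ≤ ε) :
    (Measure.pi ν).real {S | ε ≤ ∑ i ∈ t, (h (S i) - a)} ≤ Real.exp (-ε ^ 2 / (2 * t.card)) := by
  have hind : iIndepFun (fun i (S : ι → Ω) => h (S i) - a) (Measure.pi ν) :=
    iIndepFun_pi (X := fun _ z => h z - a) fun i => (hm.sub_const a).aemeasurable
  have hsub : ∀ i ∈ t, HasSubgaussianMGF (fun S : ι → Ω => h (S i) - a) 1 (Measure.pi ν) := by
    intro i hi
    have key := hasSubgaussianMGF_of_mem_Icc (μ := Measure.pi ν) (X := fun S : ι → Ω => h (S i))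
      (a := -1) (b := 1) (hm.comp (measurable_pi_apply i)).aemeasurable
      (Filter.Eventually.of_forall fun S => hb (S i))
    have hint : ∫ S, h (S i) ∂(Measure.pi ν) = a := by
      rw [← ha i hi]
      rw [← (measurePreserving_eval ν i).map_eq]
      exact (integral_map (measurable_pi_apply i).aemeasurable hm.aestronglyMeasurable).symm
    -- Hoeffding's lemma: the variance proxy is the squared half-length of the range `[-1, 1]`.
    have hc : (‖(1 : ℝ) - -1‖₊ / 2) ^ 2 = 1 := by
      ext; norm_num
    rwa [hint, hc] at key
  simpa using HasSubgaussianMGF.measure_sum_ge_le_of_iIndepFun hind hsub hε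

theorem pi_measure_abs_sum_ge_le (ν : ι → Measure Ω) [∀ i, IsProbabilityMeasure (ν i)]
    (t : Finset ι) {h : Ω → ℝ} (hm : Measurable h) (hb : ∀ z, h z ∈ Set.Icc (-1) 1) {a : ℝ}
    (ha : ∀ i ∈ t, ∫ z, h z ∂ν i = a) {ε : ℝ} (hε : 0 ≤ ε) :
    (Measure.pi ν).real {S | ε ≤ |∑ i ∈ t, (h (S i) - a)|} ≤
      2 * Real.exp (-ε ^ 2 / (2 * t.card)) := by
  have h1 := pi_measure_sum_ge_le ν t hm hb ha hε
  have h2 := pi_measure_sum_ge_le ν t hm.neg (h := fun z => -h z) (a := -a)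
    (fun z => ⟨neg_le_neg (hb z).2, by linarith [(hb z).1]⟩)
    (fun i hi => by rw [integral_neg, ha i hi]) hε
  have hu : {S : ι → Ω | ε ≤ |∑ i ∈ t, (h (S i) - a)|} ⊆
      {S | ε ≤ ∑ i ∈ t, (h (S i) - a)} ∪ {S | ε ≤ ∑ i ∈ t, (-h (S i) - -a)} := by
    intro S hS
    rcases le_abs.1 (show ε ≤ |∑ i ∈ t, (h (S i) - a)| from hS) with hle | hle
    · exact Or.inl hle
    · right
      rw [← Finset.sum_neg_distrib] at hle
      exact hle.trans_eq (Finset.sum_congr rfl fun i _ => by ring)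
  calc _ ≤ _ := measureReal_mono hu
    _ ≤ _ := measureReal_union_le _ _
    _ ≤ _ := by linarith

/-- Hoeffding's inequality for independent samples, each conditioned to lie in its own set. -/
theorem measure_pi_inter_abs_sum_ge_le (μ : ι → Measure Ω) [∀ i, IsProbabilityMeasure (μ i)]
    (s : ι → Set Ω) (hs : ∀ i, MeasurableSet (s i))
    (t : Finset ι) {h : Ω → ℝ} (hm : Measurable h) (hb : ∀ z, h z ∈ Set.Icc (-1) 1) {a : ℝ}
    (ha : ∀ i ∈ t, ∫ z, h z ∂(cond (μ i) (s i)) = a) {ε : ℝ} (hε : 0 ≤ ε) :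
    Measure.pi μ (Set.univ.pi s ∩ {S | ε ≤ |∑ i ∈ t, (h (S i) - a)|}) ≤
      ENNReal.ofReal (2 * Real.exp (-ε ^ 2 / (2 * t.card))) * Measure.pi μ (Set.univ.pi s) := by
  by_cases h0 : ∀ i, μ i (s i) ≠ 0
  · have := fun i => cond_isProbabilityMeasure (h0 i)
    rw [← cond_mul_eq_inter (MeasurableSet.univ_pi hs), cond_pi_univ_pi μ s hs h0]
    gcongr
    rw [← ofReal_measureReal]
    exact ENNReal.ofReal_le_ofReal (pi_measure_abs_sum_ge_le _ t hm hb ha hε)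
  -- A null factor makes the whole product set null.
  · push Not at h0
    obtain ⟨i, hi⟩ := h0
    refine (measure_mono Set.inter_subset_left).trans ?_
    rw [Measure.pi_pi, Finset.prod_eq_zero (Finset.mem_univ i) hi]
    exact zero_le

end Concentration

theorem softmax_mem_Icc {K : ℕ} (v : Fin K → ℝ) (k : Fin K) : softmax v k ∈ Set.Icc 0 1 := by
  have hpos : 0 ≤ ∑ l, Real.exp (v l) := Finset.sum_nonneg fun l _ => (Real.exp_pos _).le
  refine ⟨div_nonneg (Real.exp_pos _).le hpos, div_le_one_of_le₀ ?_ hpos⟩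
  exact Finset.single_le_sum (f := fun l => Real.exp (v l)) (fun l _ => (Real.exp_pos _).le)
    (Finset.mem_univ k)

theorem measurable_softmax_apply {K : ℕ} (k : Fin K) :
    Measurable fun v : Fin K → ℝ => softmax v k := by
  unfold softmax; fun_prop

theorem softmax_sub_mem_Icc {K : ℕ} (u v : Fin K → ℝ) (k : Fin K) :
    softmax u k - softmax v k ∈ Set.Icc (-1) 1 := by
  have hu := softmax_mem_Icc u k
  have hv := softmax_mem_Icc v k
  exact ⟨by linarith [hu.1, hv.2], by linarith [hu.2, hv.1]⟩

/-! ### Local events, and the law of the dataset given the local indices. -/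

section Local

variable {d K : ℕ} {𝒳 : Set (EuclideanSpace ℝ (Fin d))}

/-- The labelled points of class `j` in the local region. -/
def localEvent (j : Fin K) (x₀ : 𝒳) (r : ℝ) : Set (𝒳 × Fin K) :=
  {z | z.2 = j} ∩ Prod.fst ⁻¹' localRegion x₀ r

theorem measurableSet_localRegion (x₀ : 𝒳) (r : ℝ) : MeasurableSet (localRegion x₀ r) :=
  measurable_subtype_coe measurableSet_closedBall

theorem measurableSet_localEvent (j : Fin K) (x₀ : 𝒳) (r : ℝ) :
    MeasurableSet (localEvent j x₀ r) :=
  (measurable_snd (measurableSet_singleton j)).inter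
    (measurable_fst (measurableSet_localRegion x₀ r))

theorem cond_classLaw (D : Measure (𝒳 × Fin K)) [IsFiniteMeasure D] (j : Fin K) (x₀ : 𝒳) (r : ℝ) :
    cond (classLaw D j) (localRegion x₀ r) = (cond D (localEvent j x₀ r)).map Prod.fst := by
  have hR := measurableSet_localRegion x₀ r
  have hY : MeasurableSet {z : 𝒳 × Fin K | z.2 = j} :=
    measurable_snd (measurableSet_singleton j)
  rw [localEvent, ← cond_cond_eq_cond_inter hY (measurable_fst hR), classLaw]
  ext t ht
  rw [cond_apply hR, Measure.map_apply measurable_fst hR, Measure.map_apply measurable_fst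
    (hR.inter ht), Measure.map_apply measurable_fst ht, cond_apply (measurable_fst hR),
    Set.preimage_inter]

theorem localMeanDiff_apply (D : Measure (𝒳 × Fin K)) [IsFiniteMeasure D] (j : Fin K) (x₀ : 𝒳)
    (r : ℝ) {g₁ g₂ : 𝒳 → Fin K → ℝ} (h₁ : Measurable g₁) (h₂ : Measurable g₂) (k : Fin K) :
    localMeanDiff D j x₀ r g₁ g₂ k =
      ∫ z, (softmax (g₁ z.1) k - softmax (g₂ z.1) k) ∂(cond D (localEvent j x₀ r)) := by
  have hmeas : ∀ l, Measurable fun x => softmax (g₁ x) l - softmax (g₂ x) l := fun l =>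
    ((measurable_softmax_apply l).comp h₁).sub ((measurable_softmax_apply l).comp h₂)
  have hfin : IsFiniteMeasure (cond (classLaw D j) (localRegion x₀ r)) := by
    rw [cond_classLaw]; infer_instance
  unfold localMeanDiff
  rw [eval_integral (f := fun x => softmax (g₁ x) - softmax (g₂ x)) fun l => Integrable.of_mem_Icc (-1) 1 (hmeas l).aemeasurable
      (Filter.Eventually.of_forall fun x => softmax_sub_mem_Icc (g₁ x) (g₂ x) l), cond_classLaw]
  exact integral_map measurable_fst.aemeasurable (hmeas k).aestronglyMeasurable

theorem mem_localIndices {n : ℕ} {S : Dataset 𝒳 K n} {j : Fin K} {x₀ : 𝒳} {r : ℝ} {i : Fin n} :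
    i ∈ localIndices S j x₀ r ↔ S i ∈ localEvent j x₀ r := by
  simp [localIndices, localEvent, localRegion]

open Classical in
theorem setOf_localIndices_eq {n : ℕ} (j : Fin K) (x₀ : 𝒳) (r : ℝ) (I : Finset (Fin n)) :
    {S : Dataset 𝒳 K n | localIndices S j x₀ r = I} =
      Set.univ.pi fun i => if i ∈ I then localEvent j x₀ r else (localEvent j x₀ r)ᶜ := by
  ext S
  simp only [Set.mem_ofPred_eq, Finset.ext_iff, mem_localIndices, Set.mem_univ_pi]
  refine forall_congr' fun i => ?_
  by_cases hi : i ∈ I <;> simp [hi]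

instance isProbabilityMeasure_ite_dirac {n : ℕ} (D : Measure (𝒳 × Fin K))
    [IsProbabilityMeasure D] (z : 𝒳 × Fin K) (i₀ i : Fin n) :
    IsProbabilityMeasure (if i = i₀ then Measure.dirac z else D) := by
  split_ifs <;> infer_instance

instance isProbabilityMeasure_datasetLaw {n : ℕ} (D : Measure (𝒳 × Fin K))
    [IsProbabilityMeasure D] (i₀ : Fin n) (x₀ : 𝒳) (j : Fin K) :
    IsProbabilityMeasure (datasetLaw D i₀ x₀ j) := by
  unfold datasetLaw; infer_instance

theorem ae_mem_localIndices_datasetLaw {n : ℕ} (D : Measure (𝒳 × Fin K)) [IsProbabilityMeasure D]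
    (i₀ : Fin n) (x₀ : 𝒳) (j : Fin K) {r : ℝ} (hr : 0 ≤ r) :
    ∀ᵐ S ∂(datasetLaw D i₀ x₀ j), i₀ ∈ localIndices S j x₀ r := by
  have hmem : (x₀, j) ∈ localEvent j x₀ r := ⟨rfl, Metric.mem_closedBall_self hr⟩
  have h : ∀ᵐ z ∂(if i₀ = i₀ then Measure.dirac (x₀, j) else D), z ∈ localEvent j x₀ r := by
    rw [if_pos rfl]
    exact (ae_dirac_iff (measurableSet_localEvent j x₀ r)).2 hmem
  simp only [mem_localIndices]
  exact (measurePreserving_eval (fun i => if i = i₀ then Measure.dirac (x₀, j) else D)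
    i₀).quasiMeasurePreserving.ae h

end Local

/-! ### Arithmetic of the constants. -/

/-- If an empirical mean is at most `γ` in absolute value while `a` exceeds `γ` by a large enough
deviation, then the sum with one index removed is far from its centre. -/
theorem le_abs_sum_erase_sub {ι : Type*} [DecidableEq ι] {I : Finset ι} {i₀ : ι} (hi₀ : i₀ ∈ I)
    {x : ι → ℝ} (hx : x i₀ ∈ Set.Icc (-1) 1) {a γ L : ℝ} (ha : |a| ≤ 1) (hL : 1 / 2 ≤ L)
    (hclose : 1 / (I.card : ℝ) * |∑ i ∈ I, x i| ≤ γ)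
    (hfar : 6 * √(L / (2 * I.card)) + γ < |a|) :
    √(2 * I.card * L) ≤ |∑ i ∈ I.erase i₀, (x i - a)| := by
  have hm : (1 : ℝ) ≤ I.card := by exact_mod_cast Finset.card_pos.2 ⟨i₀, hi₀⟩
  set m : ℝ := (I.card : ℝ)
  have hs : 1 ≤ √(2 * m * L) := by
    rw [Real.one_le_sqrt]; nlinarith
  have hs2 : m * √(L / (2 * m)) = √(2 * m * L) / 2 := by
    have h4 : L / (2 * m) = 2 * m * L / (2 * m) ^ 2 := by field_simp
    rw [h4, Real.sqrt_div' _ (by positivity), Real.sqrt_sq (by positivity)]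
    field_simp
  have hsum : ∑ i ∈ I.erase i₀, (x i - a) = ∑ i ∈ I, x i - m * a - (x i₀ - a) := by
    rw [← Finset.add_sum_erase I (fun i => x i) hi₀, Finset.sum_sub_distrib, Finset.sum_const,
      nsmul_eq_mul, Finset.cast_card_erase_of_mem hi₀]
    ring
  have hclose' : |∑ i ∈ I, x i| ≤ m * γ := by
    rw [one_div, inv_mul_le_iff₀ (by positivity)] at hclose
    exact hclose
  -- Of the three copies of `√(2 * m * L)`, which is at least `1`, two absorb the removed term, at
  -- most `2`; one remains. This is where `6` comes from.
  have hfar' : 3 * √(2 * m * L) + m * γ < m * |a| := by nlinarith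
  have h1 : |x i₀ - a| ≤ 2 := by
    rw [abs_le] at ha ⊢
    exact ⟨by linarith [hx.1], by linarith [hx.2]⟩
  have h2 : m * |a| ≤ |∑ i ∈ I.erase i₀, (x i - a)| + |∑ i ∈ I, x i| + |x i₀ - a| := by
    calc m * |a| = |m * a| := by rw [abs_mul, abs_of_nonneg (by positivity : 0 ≤ m)]
      _ = |∑ i ∈ I, x i - ∑ i ∈ I.erase i₀, (x i - a) - (x i₀ - a)| := by rw [hsum]; ring_nf
      _ ≤ |∑ i ∈ I, x i - ∑ i ∈ I.erase i₀, (x i - a)| + |x i₀ - a| := abs_sub _ _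
      _ ≤ _ := by linarith [abs_sub (∑ i ∈ I, x i) (∑ i ∈ I.erase i₀, (x i - a))]
  linarith

theorem two_mul_exp_le {K c m : ℕ} (hK : 1 ≤ K) {δ : ℝ} (hδ : 0 < δ) (hc : 0 < c) (hcm : c ≤ m)
    (hL : 0 ≤ Real.log (2 * (K : ℝ) / δ)) :
    2 * Real.exp (-√(2 * m * Real.log (2 * (K : ℝ) / δ)) ^ 2 / (2 * c)) ≤ δ := by
  have hK' : (1 : ℝ) ≤ K := by exact_mod_cast hK
  have hc' : (0 : ℝ) < c := by exact_mod_cast hc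
  have hcm' : (c : ℝ) ≤ m := by exact_mod_cast hcm
  have hle : -√(2 * m * Real.log (2 * (K : ℝ) / δ)) ^ 2 / (2 * c) ≤
      -Real.log (2 * (K : ℝ) / δ) := by
    rw [Real.sq_sqrt (by positivity), div_le_iff₀ (by positivity)]
    nlinarith
  calc _ ≤ 2 * Real.exp (-Real.log (2 * (K : ℝ) / δ)) := by gcongr
    _ = δ / K := by
      rw [Real.exp_neg, Real.exp_log (by positivity)]
      field_simp
    _ ≤ δ := div_le_self hδ.le hK'

theorem half_le_log {K : ℕ} (hK : 1 ≤ K) {δ : ℝ} (hδ : 0 < δ) (hδ1 : δ < 1) :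
    1 / 2 ≤ Real.log (2 * (K : ℝ) / δ) := by
  have hK' : (1 : ℝ) ≤ K := by exact_mod_cast hK
  have h2 : (2 : ℝ) ≤ 2 * (K : ℝ) / δ := by
    rw [le_div_iff₀ hδ]; nlinarith
  linarith [Real.log_le_log two_pos h2, Real.log_two_gt_d9]

/-! ### One far pair on one fiber, and the sum over fibers. -/

section Local

variable {d K n : ℕ} {𝒳 : Set (EuclideanSpace ℝ (Fin d))}

/-- For two fixed models whose local means differ by much, it is unlikely that they are
empirically close and that the local samples are those with indices in `I`. -/
theorem datasetLaw_empiricallyClose_le (D : Measure (𝒳 × Fin K)) [IsProbabilityMeasure D]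
    {g₁ g₂ : 𝒳 → Fin K → ℝ} (h₁ : Measurable g₁) (h₂ : Measurable g₂) (j : Fin K)
    {r γ δ : ℝ} (hr : 0 < r) (hδ : 0 < δ) (hδ1 : δ < 1) {i₀ : Fin n} (x₀ : 𝒳)
    {I : Finset (Fin n)} (hi₀ : i₀ ∈ I) (hγ : 0 ≤ γ)
    (hfar : 6 * deviationRate d K r δ ((I.card : ℝ) / volume.real
        (Metric.closedBall (x₀ : EuclideanSpace ℝ (Fin d)) r)) + γ <
      ‖localMeanDiff D j x₀ r g₁ g₂‖) :
    datasetLaw D i₀ x₀ j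
        ({S | localIndices S j x₀ r = I} ∩ {S | EmpiricallyClose S j x₀ r γ g₁ g₂}) ≤
      ENNReal.ofReal δ * datasetLaw D i₀ x₀ j {S | localIndices S j x₀ r = I} := by
  classical
  have hK : 1 ≤ K := j.pos
  have hL := half_le_log hK hδ hδ1
  have hdev := sqrt_le_deviationRate (K := K) (m := I.card)
    (x₀ : EuclideanSpace ℝ (Fin d)) hr (by linarith : 0 ≤ Real.log (2 * (K : ℝ) / δ))
  set L := Real.log (2 * (K : ℝ) / δ)
  have hfar' : 6 * √(L / (2 * I.card)) + γ < ‖localMeanDiff D j x₀ r g₁ g₂‖ := by linarith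
  -- The coordinate is fixed by the population means, so no union bound over `K` is paid.
  obtain ⟨k, hk⟩ : ∃ k, 6 * √(L / (2 * I.card)) + γ < |localMeanDiff D j x₀ r g₁ g₂ k| := by
    by_contra! hcon
    exact hfar'.not_ge ((pi_norm_le_iff_of_nonneg (by positivity)).2 hcon)
  set a := localMeanDiff D j x₀ r g₁ g₂ k
  set h : 𝒳 × Fin K → ℝ := fun z => softmax (g₁ z.1) k - softmax (g₂ z.1) k
  have hm : Measurable h :=
    ((measurable_softmax_apply k).comp (h₁.comp measurable_fst)).sub
      ((measurable_softmax_apply k).comp (h₂.comp measurable_fst))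
  have hb : ∀ z, h z ∈ Set.Icc (-1) 1 := fun z => softmax_sub_mem_Icc _ _ k
  have hmean : a = ∫ z, h z ∂(cond D (localEvent j x₀ r)) := localMeanDiff_apply D j x₀ r h₁ h₂ k
  have ha1 : |a| ≤ 1 := by
    rw [hmean, ← Real.norm_eq_abs]
    refine (norm_integral_le_of_norm_le_const (C := 1)
      (Filter.Eventually.of_forall fun z => ?_)).trans ?_
    · rw [Real.norm_eq_abs, abs_le]; exact hb z
    · rw [one_mul]; exact measureReal_le_one
  set s : Fin n → Set (𝒳 × Fin K) := fun i =>
    if i ∈ I then localEvent j x₀ r else (localEvent j x₀ r)ᶜ with hs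
  have hsm : ∀ i, MeasurableSet (s i) := by
    intro i
    have := measurableSet_localEvent j x₀ r
    simp only [hs]
    split_ifs
    exacts [this, this.compl]
  rw [setOf_localIndices_eq]
  have hsub : Set.univ.pi s ∩ {S : Dataset 𝒳 K n | EmpiricallyClose S j x₀ r γ g₁ g₂} ⊆
      Set.univ.pi s ∩ {S | √(2 * I.card * L) ≤ |∑ i ∈ I.erase i₀, (h (S i) - a)|} := by
    rintro S ⟨hS, hclose⟩
    refine ⟨hS, ?_⟩
    have hSI : localIndices S j x₀ r = I := by
      have : S ∈ {S : Dataset 𝒳 K n | localIndices S j x₀ r = I} := by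
        rw [setOf_localIndices_eq]; exact hS
      exact this
    have hck := hclose k
    rw [hSI] at hck
    exact le_abs_sum_erase_sub hi₀ (x := fun i => h (S i)) (hb _) ha1 hL hck hk
  refine (measure_mono hsub).trans ?_
  have hcard : (0 : ℝ) < I.card := by exact_mod_cast Finset.card_pos.2 ⟨i₀, hi₀⟩
  -- With no sample besides `i₀` the exponential bound is void (division by `0`), but an empty sum
  -- cannot reach the positive threshold.
  rcases (I.erase i₀).eq_empty_or_nonempty with he | hne
  · refine (measure_mono_null ?_ measure_empty).le.trans zero_le
    rintro S ⟨-, hS⟩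
    have hS' : √(2 * I.card * L) ≤ |∑ i ∈ I.erase i₀, (h (S i) - a)| := hS
    rw [he, Finset.sum_empty, abs_zero] at hS'
    exact hS'.not_gt (Real.sqrt_pos.2 (by positivity))
  · refine (measure_pi_inter_abs_sum_ge_le _ s hsm (I.erase i₀) hm hb (fun i hi => ?_)
      (Real.sqrt_nonneg _)).trans ?_
    · rw [Finset.mem_erase] at hi
      simp only [hs, if_neg hi.1, if_pos hi.2]
      exact hmean.symm
    · refine mul_le_mul_left (ENNReal.ofReal_le_ofReal ?_) _
      exact two_mul_exp_le hK hδ (Finset.card_pos.2 hne)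
        (Finset.card_le_card (Finset.erase_subset _ _)) (by linarith)

/-- Only the fibers need be measurable: `A` enters through subadditivity alone. This matters because
the failure event quantifies over arbitrary parameter sets. -/
theorem measure_le_of_forall_fiber {Ω α : Type*} [MeasurableSpace Ω] [Fintype α]
    (P : Measure Ω) [IsProbabilityMeasure P] (T : Ω → α) (hT : ∀ i, MeasurableSet {ω | T ω = i})
    {A : Set Ω} {c : ENNReal} (h : ∀ i, P ({ω | T ω = i} ∩ A) ≤ c * P {ω | T ω = i}) :
    P A ≤ c := by
  have hA : A ⊆ ⋃ i, {ω | T ω = i} ∩ A := fun ω hω => Set.mem_iUnion.2 ⟨T ω, rfl, hω⟩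
  have hdisj : Pairwise (Function.onFun Disjoint fun i => {ω | T ω = i}) := by
    intro i i' hne
    exact Set.disjoint_left.2 fun ω h1 h2 => hne (h1.symm.trans h2)
  calc P A ≤ ∑ i, P ({ω | T ω = i} ∩ A) :=
        (measure_mono hA).trans (measure_iUnion_fintype_le _ _)
    _ ≤ ∑ i, c * P {ω | T ω = i} := Finset.sum_le_sum fun i _ => h i
    _ = c * P (⋃ i, {ω | T ω = i}) := by
        rw [measure_iUnion hdisj hT, tsum_fintype, Finset.mul_sum]
    _ ≤ c := mul_le_of_le_one_right' prob_le_one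

theorem measurableSet_localIndices_eq (j : Fin K) (x₀ : 𝒳) (r : ℝ) (I : Finset (Fin n)) :
    MeasurableSet {S : Dataset 𝒳 K n | localIndices S j x₀ r = I} := by
  classical
  have := measurableSet_localEvent j x₀ r
  rw [setOf_localIndices_eq]
  refine MeasurableSet.univ_pi fun i => ?_
  split_ifs
  exacts [this, this.compl]

end Local

end LocalConsistency

theorem theorem1 :
    ∃ C : ℝ, 0 < C ∧
      ∀ (d K n : ℕ) (𝒳 : Set (EuclideanSpace ℝ (Fin d)))
        (D : MeasureTheory.Measure (𝒳 × Fin K)) [MeasureTheory.IsProbabilityMeasure D]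
        (Θ₁ Θ₂ : Type*) (W₁ : Set Θ₁) (W₂ : Set Θ₂)
        (f₁ : Θ₁ → 𝒳 → Fin K → ℝ) (f₂ : Θ₂ → 𝒳 → Fin K → ℝ)
        (_ : ∀ w₁ ∈ W₁, Measurable (f₁ w₁)) (_ : ∀ w₂ ∈ W₂, Measurable (f₂ w₂))
        (j : Fin K) (r : ℝ) (_ : 0 < r) (γ : ℝ) (δ : ℝ) (_ : 0 < δ) (_ : δ < 1)
        (i₀ : Fin n) (x₀ : 𝒳),
        LocalConsistency.datasetLaw D i₀ x₀ j
          {S : LocalConsistency.Dataset 𝒳 K n | ¬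
            ((∀ w₁ ∈ W₁, ∀ w₂ ∈ W₂,
                LocalConsistency.EmpiricallyClose S j x₀ r γ (f₁ w₁) (f₂ w₂)) →
              ∀ w₁ ∈ W₁, ∀ w₂ ∈ W₂,
                ‖LocalConsistency.localMeanDiff D j x₀ r (f₁ w₁) (f₂ w₂)‖ ≤
                  C * LocalConsistency.deviationRate d K r δ
                    (LocalConsistency.localDensity S j x₀ r) + γ)}
          ≤ ENNReal.ofReal δ := by
  refine ⟨6, by norm_num, ?_⟩
  intro d K n 𝒳 D _ Θ₁ Θ₂ W₁ W₂ f₁ f₂ hf₁ hf₂ j r hr γ δ hδ hδ1 i₀ x₀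
  refine LocalConsistency.measure_le_of_forall_fiber _
    (fun S => LocalConsistency.localIndices S j x₀ r)
    (LocalConsistency.measurableSet_localIndices_eq j x₀ r) fun I => ?_
  -- The sample `i₀` is almost surely the centre of the ball, so fibers with `i₀ ∉ I` are null.
  by_cases hi₀ : i₀ ∈ I
  swap
  · have h0 : LocalConsistency.datasetLaw D i₀ x₀ j
        {S | LocalConsistency.localIndices S j x₀ r = I} = 0 := by
      refine measure_mono_null (fun S hS => ?_)
        (ae_iff.1 (LocalConsistency.ae_mem_localIndices_datasetLaw D i₀ x₀ j hr.le))
      rw [Set.mem_ofPred_eq] at hS ⊢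
      rwa [hS]
    exact (measure_mono_null Set.inter_subset_left h0).le.trans zero_le
  by_cases hfar : 0 ≤ γ ∧ ∃ w₁ ∈ W₁, ∃ w₂ ∈ W₂,
      6 * LocalConsistency.deviationRate d K r δ ((I.card : ℝ) / volume.real
        (Metric.closedBall (x₀ : EuclideanSpace ℝ (Fin d)) r)) + γ <
      ‖LocalConsistency.localMeanDiff D j x₀ r (f₁ w₁) (f₂ w₂)‖
  · obtain ⟨hγ, w₁, hw₁, w₂, hw₂, hlt⟩ := hfar
    refine (measure_mono ?_).trans (LocalConsistency.datasetLaw_empiricallyClose_le D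
      (hf₁ w₁ hw₁) (hf₂ w₂ hw₂) j hr hδ hδ1 x₀ hi₀ hγ hlt)
    rintro S ⟨hS, hbad⟩
    exact ⟨hS, (Classical.not_imp.1 hbad).1 w₁ hw₁ w₂ hw₂⟩
  · refine (measure_mono_null ?_ measure_empty).le.trans zero_le
    rintro S ⟨hS, hbad⟩
    obtain ⟨hclose, hnot⟩ := Classical.not_imp.1 hbad
    push Not at hnot
    obtain ⟨w₁, hw₁, w₂, hw₂, hlt⟩ := hnot
    refine hfar ⟨?_, w₁, hw₁, w₂, hw₂, ?_⟩
    -- Empirical closeness bounds a nonnegative quantity by `γ`, so failure forces `0 ≤ γ`.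
    · exact le_trans (by positivity) (hclose w₁ hw₁ w₂ hw₂ j)
    · rw [LocalConsistency.localDensity, show LocalConsistency.localIndices S j x₀ r = I from hS]
        at hlt
      exact hlt
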